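/- Let $g\ge 1$ and let $\Sigma$ be a closed, connected, orientable surface of genus $g$, i.e. a space homeomorphic to the quotient of the polygon with $4g$ sides by the side identifications $a_1b_1a_1^{-1}b_1^{-1}\cdots a_gb_ga_g^{-1}b_g^{-1}$. Let $\Gamma$ be a finite graph (loops and multiple edges allowed) embedded in $\Sigma$. The faces of $\Gamma$ are the connected components of $\Sigma\setminus\Gamma$. Assume that $\Gamma$ is a map, i.e. that every face is homeomorphic to an open disk. For an oriented edge $e$ let $\bar e$ be the same edge with the opposite orientation. Let $G$ be a group. A $G$-connection on $\Gamma$ is a function $\phi$ from the set of oriented edges of $\Gamma$ to $G$ such that $\phi(\bar e)=\phi(e)^{-1}$ for every $e$. A loop in $\Gamma$ is a sequence $(e_1,\dots,e_n)$, $n\ge 1$, of oriented edges such that the head of each edge is the tail of the next one, cyclically; the holonomy of $\phi$ along it is $\phi(e_1)\phi(e_2)\cdots\phi(e_n)\in G$. A boundary loop of a face $F$ is a loop $(e_1,\dots,e_n)$ for which there is a continuous map from the closed $n$-gon to $\Sigma$ that restricts to a homeomorphism from the open $n$-gon onto $F$ and maps the successive sides of the $n$-gon along $e_1,\dots,e_n$.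 The holonomy of $\phi$ around $F$ is its holonomy along a boundary loop of $F$. (Choosing another base vertex or direction replaces it by a conjugate or by the inverse of a conjugate, so its being trivial or not does not depend on the choice.) Suppose that $G$ is non-abelian, and fix a face $F_0$ of $\Gamma$. Then there exists a $G$-connection on $\Gamma$ whose holonomy around every face $F\neq F_0$ is trivial (for every boundary loop of $F$), while its holonomy around $F_0$ is non-trivial (for every boundary loop of $F_0$). -/

import Mathlib

namespace SurfaceGraph

/-- A graph (loops and multiple edges allowed), given by its vertices `V` and its oriented edges
`E`. Each edge has exactly two orientations, exchanged by `bar`. -/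
structure OrientedGraph (V E : Type*) where
  tail : E → V
  head : E → V
  bar : E → E
  bar_bar : ∀ e, bar (bar e) = e
  bar_ne : ∀ e, bar e ≠ e
  tail_bar : ∀ e, tail (bar e) = head e
  head_bar : ∀ e, head (bar e) = tail e

namespace OrientedGraph

variable {V E : Type*}

/-- A `G`-connection on a graph: `φ (ē) = φ (e)⁻¹`. -/
structure Connection (Γ : OrientedGraph V E) (G : Type*) [Group G] where
  val : E → G
  val_bar : ∀ e, val (Γ.bar e) = (val e)⁻¹

/-- A loop `(e₁, …, eₙ)`, `n ≥ 1`, of oriented edges, based at the tail of `e₁`: the head of each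
edge is the tail of the next one, cyclically. -/
structure Loop (Γ : OrientedGraph V E) where
  len : ℕ
  len_pos : 0 < len
  edge : Fin len → E
  head_eq_tail : ∀ i j : Fin len, (j : ℕ) = ((i : ℕ) + 1) % len →
    Γ.head (edge i) = Γ.tail (edge j)

/-- The holonomy `φ(e₁) φ(e₂) ⋯ φ(eₙ)` of a connection along a loop. -/
def Connection.holonomy {Γ : OrientedGraph V E} {G : Type*} [Group G] (φ : Γ.Connection G)
    (w : Γ.Loop) : G :=
  (List.ofFn fun i => φ.val (w.edge i)).prod

/-- An embedding of a graph in a topological space `S`: vertices go to distinct points, every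
oriented edge `e` goes to a path `arc e` from its tail to its head, which is run backwards by
`bar e`; the interiors of edges contain no vertices, have no self-intersections and are disjoint
for distinct (unoriented) edges. -/
structure Embedding (Γ : OrientedGraph V E) (S : Type*) [TopologicalSpace S] where
  point : V → S
  point_injective : Function.Injective point
  arc : ∀ e : E, Path (point (Γ.tail e)) (point (Γ.head e))
  arc_bar : ∀ (e : E) (t : unitInterval), arc (Γ.bar e) t = arc e (unitInterval.symm t)
  arc_ne_point : ∀ (e : E) (t : unitInterval) (v : V), 0 < t → t < 1 → arc e t ≠ point v
  arc_eq_arc : ∀ (e e' : E) (t t' : unitInterval), 0 < t → t < 1 → 0 < t' → t' < 1 →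
    arc e t = arc e' t' → (e' = e ∧ t' = t) ∨ (e' = Γ.bar e ∧ t' = unitInterval.symm t)

end OrientedGraph

/-- The point with parameter `s` on the boundary of the regular polygon with `n` sides, modelled as
the closed unit disk: the `k`-th side (`k = 0, …, n - 1`) is the arc `k ≤ s ≤ k + 1`, and the
boundary is run through counterclockwise as `s` goes from `0` to `n`. -/
noncomputable def polygonPoint (n : ℕ) (s : ℝ) : Metric.closedBall (0 : ℂ) 1 :=
  ⟨(Circle.exp (2 * Real.pi * s / n) : ℂ), by
    rw [mem_closedBall_zero_iff, Circle.norm_coe]⟩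

/-- The side identifications of the polygon with `4g` sides according to the word
`a₁ b₁ a₁⁻¹ b₁⁻¹ ⋯ a_g b_g a_g⁻¹ b_g⁻¹`: side `4j` is glued to side `4j + 2` and side `4j + 1` to
side `4j + 3`, in both cases with reversal of the direction. -/
inductive SideGluing (g : ℕ) : Metric.closedBall (0 : ℂ) 1 → Metric.closedBall (0 : ℂ) 1 → Prop
  | a (j : ℕ) (hj : j < g) (t : unitInterval) :
      SideGluing g (polygonPoint (4 * g) (4 * j + (t : ℝ))) (polygonPoint (4 * g) (4 * j + 3 - (t : ℝ)))
  | b (j : ℕ) (hj : j < g) (t : unitInterval) :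
      SideGluing g (polygonPoint (4 * g) (4 * j + 1 + (t : ℝ))) (polygonPoint (4 * g) (4 * j + 4 - (t : ℝ)))

/-- The standard closed orientable surface of genus `g ≥ 1`: the quotient of the polygon with `4g`
sides by the (equivalence relation generated by the) side identifications, with the quotient
topology. -/
abbrev StandardSurface (g : ℕ) : Type := Quot (SideGluing g)

/-- `S` is a closed, connected, orientable surface of genus `g`, where `g ≥ 1`. -/
def IsClosedOrientableSurface (g : ℕ) (S : Type*) [TopologicalSpace S] : Prop :=
  1 ≤ g ∧ Nonempty (S ≃ₜ StandardSurface g)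

namespace OrientedGraph.Embedding

variable {V E : Type*} {Γ : OrientedGraph V E} {S : Type*} [TopologicalSpace S]

/-- The subset of the surface covered by the embedded graph. -/
def support (ι : Γ.Embedding S) : Set S :=
  Set.range ι.point ∪ ⋃ e, Set.range (ι.arc e)

/-- Faces are the connected components of the complement of the graph. -/
def IsFace (ι : Γ.Embedding S) (F : Set S) : Prop :=
  ∃ x ∈ ι.supportᶜ, F = connectedComponentIn ι.supportᶜ x

/-- An embedded graph is a map if all its faces are homeomorphic to the open disk. -/
def IsMap (ι : Γ.Embedding S) : Prop :=
  ∀ F, ι.IsFace F → Nonempty (F ≃ₜ Metric.ball (0 : ℂ) 1)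

/-- The loop `w = (e₁, …, eₙ)` is a boundary loop of the face `F`: there is a continuous map from
the closed `n`-gon to the surface which restricts to a homeomorphism from the open polygon onto `F`
and which maps the successive sides of the polygon along `e₁, …, eₙ`. The choices of the base vertex
and of the direction are left free. -/
def IsBoundaryLoop (ι : Γ.Embedding S) (F : Set S) (w : Γ.Loop) : Prop :=
  ∃ h : C(Metric.closedBall (0 : ℂ) 1, S),
    (∃ H : Metric.ball (0 : ℂ) 1 ≃ₜ F,
      ∀ z, (H z : S) = h ⟨z, Metric.ball_subset_closedBall z.2⟩) ∧
    ∀ (i : Fin w.len) (t : unitInterval),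
      h (polygonPoint w.len ((i : ℕ) + (t : ℝ))) = ι.arc (w.edge i) t

/-- The holonomy around the face `F` is trivial, for every choice of the base vertex and of the
direction in which the boundary is traversed. -/
def TrivialHolonomy (ι : Γ.Embedding S) {G : Type*} [Group G] (φ : Γ.Connection G)
    (F : Set S) : Prop :=
  ∀ w : Γ.Loop, ι.IsBoundaryLoop F w → φ.holonomy w = 1

/-- The holonomy around the face `F` is non-trivial, for every choice of the base vertex and of the
direction in which the boundary is traversed. -/
def NontrivialHolonomy (ι : Γ.Embedding S) {G : Type*} [Group G] (φ : Γ.Connection G)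
    (F : Set S) : Prop :=
  ∀ w : Γ.Loop, ι.IsBoundaryLoop F w → φ.holonomy w ≠ 1

end OrientedGraph.Embedding

end SurfaceGraph

namespace SurfaceGraph

open Topology unitInterval

/-! ### A space with a free discontinuous group action -/

/-! Take a free discontinuous action of `G` on a space `Z` with a point `z₀` joined by paths to all
its translates, and let `p : Z → Z/G` be the resulting covering. Choose `x`, `y` in `G` that do not
commute. Map the boundary of the `4g`-gon to `Z/G`: the first handle runs along the projections of
paths from `z₀` to `x • z₀` and `y • z₀` in the commutator pattern, and all other handles are
constant. This respects the side identifications, so it extends radially to the surface punctured at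
a point `q` of `F₀` in the open polygon (`exists_radial_extension`). Around the puncture, the
pulled-back covering has monodromy `x y x⁻¹ y⁻¹ ≠ 1`.

The connection is the monodromy of this pulled-back covering along the edges, relative to a chosen
point in the fibre over each vertex (`exists_connection`); a loop has trivial holonomy exactly when
its lifts close up (`holonomy_eq_one_iff`). A face other than `F₀` misses the puncture, so the map
lifts over the whole closed polygon of any of its boundary loops, and the holonomy is trivial
(`IsMonodromy.trivialHolonomy`). If some boundary loop of `F₀` had trivial holonomy, the map would
lift over the punctured face (`IsMonodromy.exists_lift_punctured_face`). A small circle around `q`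
would then have a closed lift, although its lifts move by the commutator. No fundamental group of
the surface has to be computed. -/

/-- The join of two copies of the discrete space `G`, slightly thickened: pairs of multiples of
delta functions on `G`, not both zero. -/
def JoinSpace (G : Type*) : Type _ :=
  {f : Bool → G → ℝ // (∀ b g g', f b g ≠ 0 → f b g' ≠ 0 → g = g') ∧ ∃ b g, f b g ≠ 0}

namespace JoinSpace

variable {G : Type*}

instance : TopologicalSpace (JoinSpace G) := inferInstanceAs (TopologicalSpace (Subtype _))

variable [Group G]

instance : MulAction G (JoinSpace G) where
  smul h f := ⟨fun b g => f.1 b (h⁻¹ * g),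
    fun b g g' hg hg' => mul_left_cancel (f.2.1 b _ _ hg hg'), by
      obtain ⟨b, g, hg⟩ := f.2.2
      exact ⟨b, h * g, by simpa using hg⟩⟩
  one_smul f := Subtype.ext <| by
    funext b g
    change f.1 b (1⁻¹ * g) = f.1 b g
    simp
  mul_smul h k f := Subtype.ext <| by
    funext b g
    change f.1 b ((h * k)⁻¹ * g) = f.1 b (k⁻¹ * (h⁻¹ * g))
    simp [mul_assoc]

theorem smul_val (h : G) (f : JoinSpace G) (b : Bool) (g : G) :
    (h • f).1 b g = f.1 b (h⁻¹ * g) := rfl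

omit [Group G] in
theorem continuous_coord (b : Bool) (g : G) : Continuous fun f : JoinSpace G => f.1 b g :=
  (continuous_apply_apply (ρ := fun (_ : Bool) (_ : G) => ℝ) b g).comp continuous_subtype_val

instance : ContinuousConstSMul G (JoinSpace G) where
  continuous_const_smul h := by
    refine Continuous.subtype_mk (continuous_pi fun b => continuous_pi fun g => ?_) _
    exact continuous_coord b (h⁻¹ * g)

/-- Around `f`, fix a coordinate `(b, g)` at which `f` is nonzero. If both `f'` and `h • f'` are
nonzero there, then `f'` is nonzero at `(b, g)` and at `(b, h⁻¹ * g)`. Each copy of `G` supports at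
most one nonzero coordinate, which forces `h = 1`. -/
theorem isQuotientCoveringMap :
    IsQuotientCoveringMap (Quotient.mk (MulAction.orbitRel G (JoinSpace G))) G where
  toIsQuotientMap := isQuotientMap_quotient_mk'
  toContinuousConstSMul := inferInstance
  apply_eq_iff_mem_orbit := Quotient.eq''
  disjoint f := by
    obtain ⟨b, g, hg⟩ := f.2.2
    refine ⟨{f' | f'.1 b g ≠ 0},
      (isOpen_ne_fun (continuous_coord b g) continuous_const).mem_nhds hg, ?_⟩
    rintro h ⟨_, ⟨f', hf', rfl⟩, hf''⟩
    have := f'.2.1 b _ _ hf' hf''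
    simpa using this

/-- The vertex `1` of the first copy of `G`. -/
noncomputable def base : JoinSpace G := by
  classical
  exact ⟨fun b g => if b = false ∧ g = 1 then 1 else 0, by
    intro b g g' h h'
    simp only [ne_eq, ite_eq_right_iff, one_ne_zero, imp_false, not_not] at h h'
    rw [h.2, h'.2], false, 1, by simp⟩

theorem joined_base_smul (h : G) : Joined (base : JoinSpace G) (h • base) := by
  classical
  -- In the first copy the mass at `1` shrinks to zero on `[0, 1/2]`, and the mass at `h` grows on
  -- `[1/2, 1]`. The term `t * (1 - t)` in the second copy keeps the point nonzero in between.
  let F : ℝ → Bool → G → ℝ := fun t b g =>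
    if b = false then (if g = 1 then max (1 - 2 * t) 0 else 0) + (if g = h then max (2 * t - 1) 0 else 0)
    else if g = 1 then t * (1 - t) else 0
  have hF : ∀ t : I, (∀ b g g', F t b g ≠ 0 → F t b g' ≠ 0 → g = g') ∧ ∃ b g, F t b g ≠ 0 := by
    intro t
    constructor
    · intro b g g' hg hg'
      cases b
      · rcases le_total (1 - 2 * (t : ℝ)) 0 with ht | ht
        · simp only [F, if_true, max_eq_right ht, ite_self, zero_add, ne_eq, ite_eq_right_iff,
            Classical.not_imp] at hg hg'
          rw [hg.1, hg'.1]
        · simp only [F, if_true, max_eq_right (by linarith : 2 * (t : ℝ) - 1 ≤ 0), ite_self,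
            add_zero, ne_eq, ite_eq_right_iff, Classical.not_imp] at hg hg'
          rw [hg.1, hg'.1]
      · simp only [F, Bool.true_eq_false, if_false, ne_eq, ite_eq_right_iff,
          Classical.not_imp] at hg hg'
        rw [hg.1, hg'.1]
    · by_cases h0 : (t : ℝ) = 0
      · refine ⟨false, 1, ?_⟩
        by_cases h1 : (1 : G) = h <;> simp [F, h0, h1]
      by_cases h1 : (t : ℝ) = 1
      · refine ⟨false, h, ?_⟩
        by_cases h1' : h = 1 <;> simp [F, h1, h1'] <;> norm_num
      · exact ⟨true, 1, by simp [F, h0, sub_eq_zero, Ne.symm h1]⟩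
  refine ⟨⟨⟨fun t => ⟨F t, hF t⟩, Continuous.subtype_mk (continuous_pi fun b => continuous_pi fun g => ?_) _⟩, ?_, ?_⟩⟩
  · simp only [F]
    split_ifs <;> fun_prop
  · refine Subtype.ext (funext fun b => funext fun g => ?_)
    cases b
    · by_cases h1 : g = 1 <;> simp [F, base, h1]
    · simp [F, base]
  · refine Subtype.ext (funext fun b => funext fun g => ?_)
    rw [smul_val]
    cases b
    · by_cases h1 : g = h <;> simp [F, base, h1, inv_mul_eq_one, eq_comm (a := h)] <;> norm_num
    · simp [F, base]

end JoinSpace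

/-! ### Connections from covering maps -/

section Monodromy

open OrientedGraph

variable {G Z Y : Type*} [Group G] [TopologicalSpace Z] [TopologicalSpace Y] [MulAction G Z]
  {p : Z → Y} (hp : IsQuotientCoveringMap p G)
include hp

theorem smul_eq_smul_iff_of_covering (a b : G) (z : Z) : a • z = b • z ↔ a = b :=
  have := hp.isCancelSMul
  ⟨fun h => IsCancelSMul.right_cancel _ _ _ h, fun h => h ▸ rfl⟩

/-- The monodromy connection of a family of paths in the base of a covering. -/
theorem exists_connection {V E : Type*} (Γ : OrientedGraph V E) (y : V → Y) (c : E → C(I, Y))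
    (h0 : ∀ e, c e 0 = y (Γ.tail e)) (h1 : ∀ e, c e 1 = y (Γ.head e))
    (hbar : ∀ e t, c (Γ.bar e) t = c e (σ t)) :
    ∃ (s : V → Z) (φ : Γ.Connection G), (∀ v, p (s v) = y v) ∧
      ∀ e (Λ : C(I, Z)), (∀ t, p (Λ t) = c e t) → ∀ a : G, Λ 0 = a • s (Γ.tail e) →
        Λ 1 = (a * φ.val e) • s (Γ.head e) := by
  have := hp.toContinuousConstSMul
  choose s hs using fun v => hp.surjective (y v)
  have hstart : ∀ e, c e 0 = p (s (Γ.tail e)) := fun e => by rw [h0, hs]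
  let Λ₀ : E → C(I, Z) := fun e => hp.isCoveringMap.liftPath (c e) (s (Γ.tail e)) (hstart e)
  have hΛ₀ : ∀ e t, p (Λ₀ e t) = c e t := fun e t =>
    congr_fun (hp.isCoveringMap.liftPath_lifts (c e) _ (hstart e)) t
  have hΛ₀0 : ∀ e, Λ₀ e 0 = s (Γ.tail e) := fun e => hp.isCoveringMap.liftPath_zero ..
  have hend : ∀ e, ∃ k : G, k • s (Γ.head e) = Λ₀ e 1 := fun e =>
    hp.apply_eq_iff_mem_orbit.1 (by rw [hΛ₀, h1, hs])
  choose φ hφ using hend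
  have huniq : ∀ e (Λ : C(I, Z)), (∀ t, p (Λ t) = c e t) → ∀ a : G, Λ 0 = a • s (Γ.tail e) →
      Λ 1 = (a * φ e) • s (Γ.head e) := by
    intro e Λ hΛ a ha
    -- Translates of lifts are lifts, so by uniqueness `Λ` is the translate by `a` of the reference
    -- lift.
    have h := hp.isCoveringMap.eq_of_comp_eq (g₁ := Λ) (g₂ := fun t => a • Λ₀ e t) Λ.continuous
      ((Λ₀ e).continuous.const_smul a) (by
        funext t
        simp only [Function.comp, hΛ, hp.map_smul, hΛ₀]) 0 (by simp only [ha, hΛ₀0])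
    rw [congr_fun h 1, mul_smul, hφ]
  refine ⟨s, ⟨φ, fun e => ?_⟩, hs, huniq⟩
  -- The reversed reference lift, translated by `(φ e)⁻¹` so as to start at the chosen point over
  -- the head of `e`, ends at `(φ e)⁻¹ • s (Γ.tail e)`. This gives the value on `Γ.bar e`.
  have hc : Continuous fun t => (φ e)⁻¹ • Λ₀ e (σ t) :=
    ((Λ₀ e).continuous.comp unitInterval.continuous_symm).const_smul _
  have h := huniq (Γ.bar e) ⟨_, hc⟩ (fun t => by simp [hp.map_smul, hΛ₀, hbar]) 1 (by
    simp only [ContinuousMap.coe_mk, unitInterval.symm_zero, ← hφ, inv_smul_smul, one_smul,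
      Γ.tail_bar])
  simp only [ContinuousMap.coe_mk, unitInterval.symm_one, hΛ₀0, one_mul, Γ.head_bar] at h
  exact ((smul_eq_smul_iff_of_covering hp _ _ _).1 h).symm

/-- Each edge multiplies the group coordinate of the lift on the right by its value. After `k` edges
the lift is therefore at `a` times the partial product of the holonomy, and freeness of the action
compares its two ends. -/
theorem holonomy_eq_one_iff {V E : Type*} {Γ : OrientedGraph V E} {y : V → Y} {c : E → C(I, Y)}
    (h0 : ∀ e, c e 0 = y (Γ.tail e))
    {s : V → Z} {φ : Γ.Connection G} (hs : ∀ v, p (s v) = y v)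
    (hφ : ∀ e (Λ : C(I, Z)), (∀ t, p (Λ t) = c e t) → ∀ a : G, Λ 0 = a • s (Γ.tail e) →
        Λ 1 = (a * φ.val e) • s (Γ.head e))
    (w : Γ.Loop) (K : C(ℝ, Z))
    (hK : ∀ (i : Fin w.len) (t : I), p (K ((i : ℕ) + (t : ℝ))) = c (w.edge i) t) :
    φ.holonomy w = 1 ↔ K w.len = K 0 := by
  have hn := w.len_pos
  -- Reducing indices modulo the length makes `ed w.len = ed 0`, so the return to the base vertex is
  -- an ordinary step of the induction.
  let ed : ℕ → E := fun k => w.edge ⟨k % w.len, Nat.mod_lt _ hn⟩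
  let P : ℕ → G := fun k => ((List.range k).map fun i => φ.val (ed i)).prod
  have hol : φ.holonomy w = P w.len := by
    unfold Connection.holonomy
    simp only [P]
    congr 1
    apply List.ext_getElem
    · simp
    · intro i h1 h2
      simp only [List.length_ofFn] at h1
      simp [ed, Nat.mod_eq_of_lt h1]
  obtain ⟨a, ha⟩ : ∃ a : G, a • s (Γ.tail (ed 0)) = K 0 := by
    refine hp.apply_eq_iff_mem_orbit.1 ?_
    have := hK ⟨0, hn⟩ 0
    simp only [Nat.cast_zero, Set.Icc.coe_zero, add_zero] at this
    rw [this, hs, h0]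
    simp [ed]
  have key : ∀ k ≤ w.len, K k = (a * P k) • s (Γ.tail (ed k)) := by
    intro k
    induction k with
    | zero => simp [P, ha]
    | succ k ih =>
      intro hk
      have hk' : k < w.len := hk
      have hedk : ed k = w.edge ⟨k, hk'⟩ := by simp [ed, Nat.mod_eq_of_lt hk']
      have h := hφ (ed k) ⟨fun t => K ((k : ℝ) + t), by fun_prop⟩ (fun t => by
        rw [hedk]; exact hK ⟨k, hk'⟩ t) (a * P k) (by simpa using ih hk'.le)
      have hP : P (k + 1) = P k * φ.val (ed k) := by simp [P, List.prod_range_succ]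
      have hv : Γ.head (ed k) = Γ.tail (ed (k + 1)) := by
        rw [hedk]
        exact w.head_eq_tail _ _ rfl
      simp only [ContinuousMap.coe_mk, Set.Icc.coe_one] at h
      rw [hP, ← mul_assoc, ← hv, ← h]
      push_cast
      rfl
  have hlast := key w.len le_rfl
  have hed : ed w.len = ed 0 := by simp [ed]
  rw [hol, hlast, hed, ← ha, smul_eq_smul_iff_of_covering hp]
  simp

end Monodromy

open Topology unitInterval Set

/-! ### The unit circle and the unit disk -/

theorem exists_continuousMap_circle {X : Type*} [TopologicalSpace X] {n : ℕ} (hn : 0 < n)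
    {f : ℝ → X} (hf : ContinuousOn f (Icc 0 n)) (h : f 0 = f n) :
    ∃ F : C(Circle, X), ∀ s ∈ Icc (0 : ℝ) n, F (Circle.exp (2 * Real.pi * s / n)) = f s := by
  have hn' : (0 : ℝ) < n := by exact_mod_cast hn
  have : Fact ((0 : ℝ) < n) := ⟨hn'⟩
  let e := AddCircle.homeomorphCircle hn'.ne'
  refine ⟨⟨AddCircle.liftIco (n : ℝ) 0 f ∘ e.symm,
    (AddCircle.liftIco_zero_continuous h hf).comp e.symm.continuous⟩, fun s hs => ?_⟩
  have he : ∀ s : ℝ, Circle.exp (2 * Real.pi * s / n) = e (s : AddCircle (n : ℝ)) := fun s => by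
    rw [AddCircle.homeomorphCircle_apply, AddCircle.toCircle_apply_mk]
    congr 1
    ring
  simp only [ContinuousMap.coe_mk, Function.comp, he, Homeomorph.symm_apply_apply]
  rcases hs.2.lt_or_eq with hlt | rfl
  · exact AddCircle.liftIco_zero_coe_apply ⟨hs.1, hlt⟩
  · rw [AddCircle.coe_period, ← AddCircle.coe_zero,
      AddCircle.liftIco_zero_coe_apply ⟨le_rfl, hn'⟩, h]

theorem exists_circle_exp_eq {n : ℕ} (hn : 0 < n) (c : Circle) :
    ∃ s ∈ Ico (0 : ℝ) n, Circle.exp (2 * Real.pi * s / n) = c := by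
  have hn' : (0 : ℝ) < n := by exact_mod_cast hn
  have : Fact ((0 : ℝ) < n) := ⟨hn'⟩
  let e := AddCircle.homeomorphCircle hn'.ne'
  obtain ⟨s, hs, h⟩ := AddCircle.coe_image_Ico_eq (n : ℝ) 0 ▸ mem_univ (e.symm c)
  refine ⟨s, by simpa using hs, ?_⟩
  rw [← e.apply_symm_apply c, ← h, AddCircle.homeomorphCircle_apply, AddCircle.toCircle_apply_mk]
  congr 1
  ring

theorem isInducing_circle_coe : IsInducing (X := Circle) fun c => (c : ℂ) := IsInducing.subtypeVal

/-- The radial projection of the plane from a point `q` of the open unit disk to the unit circle. -/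
theorem exists_radial_projection {q : ℂ} (hq : ‖q‖ < 1) :
    ∃ ρ : ℂ → Circle, ContinuousOn ρ {q}ᶜ ∧
      (∀ (c : Circle) (r : ℝ), 0 < r → ρ (q + r * (c - q)) = c) ∧
      ∀ z, z ≠ q → ∃ r : ℝ, 0 < r ∧ (ρ z : ℂ) = q + r * (z - q) := by
  -- The ray `q + t (z - q)` meets the unit circle where `A t² + 2 B t - C = 0`. As `A > 0` and `C >
  -- 0`, the roots have opposite signs, and `T` is the positive one.
  let A : ℂ → ℝ := fun z => Complex.normSq (z - q)
  let B : ℂ → ℝ := fun z => q.re * (z - q).re + q.im * (z - q).im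
  let C : ℝ := 1 - Complex.normSq q
  have hC : 0 < C := by
    simp only [C, Complex.normSq_eq_norm_sq]
    nlinarith [norm_nonneg q]
  have hA : ∀ z, z ≠ q → 0 < A z := fun z hz => Complex.normSq_pos.2 (sub_ne_zero.2 hz)
  have hnorm : ∀ (z : ℂ) (t : ℝ), ‖q + t * (z - q)‖ = 1 ↔ A z * t ^ 2 + 2 * B z * t - C = 0 := by
    intro z t
    have : Complex.normSq (q + t * (z - q)) - 1 = A z * t ^ 2 + 2 * B z * t - C := by
      simp only [A, B, C, Complex.normSq_apply, Complex.add_re, Complex.add_im, Complex.mul_re,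
        Complex.mul_im, Complex.ofReal_re, Complex.ofReal_im]
      ring
    rw [← this, sub_eq_zero, Complex.normSq_eq_norm_sq, 
      pow_eq_one_iff_of_nonneg (norm_nonneg _) two_ne_zero]
  let T : ℂ → ℝ := fun z => (-B z + √(B z ^ 2 + A z * C)) / A z
  have hsq : ∀ z, z ≠ q → √(B z ^ 2 + A z * C) ^ 2 = B z ^ 2 + A z * C := fun z hz =>
    Real.sq_sqrt (by have := mul_pos (hA z hz) hC; positivity)
  have hT0 : ∀ z, z ≠ q → 0 < T z := by
    intro z hz
    refine div_pos ?_ (hA z hz)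
    have := Real.lt_sqrt_of_sq_lt (x := |B z|) (y := B z ^ 2 + A z * C) (by
      rw [sq_abs]; linarith [mul_pos (hA z hz) hC])
    linarith [le_abs_self (B z)]
  have hT : ∀ z, z ≠ q → A z * T z ^ 2 + 2 * B z * T z - C = 0 := by
    intro z hz
    have h1 := hsq z hz
    have h2 := (hA z hz).ne'
    simp only [T]
    field_simp
    linear_combination h1
  have huniq : ∀ z, z ≠ q → ∀ t : ℝ, 0 < t → ‖q + t * (z - q)‖ = 1 → t = T z := by
    intro z hz t ht h
    rw [hnorm] at h
    have h' := hT z hz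
    have hT0 := hT0 z hz
    have hA := hA z hz
    have h1 : (t - T z) * (A z * (t + T z) + 2 * B z) = 0 := by linear_combination h - h'
    have h2 : 0 < A z * t + 2 * B z := by
      by_contra hneg
      nlinarith
    have h3 : 0 < A z * (t + T z) + 2 * B z := by nlinarith
    rcases mul_eq_zero.1 h1 with h1 | h1
    · linarith
    · linarith
  have hTn : ∀ z, z ≠ q → ‖q + T z * (z - q)‖ = 1 := fun z hz => (hnorm _ _).2 (hT z hz)
  classical
  -- The default value `1` is taken only at `z = q`.
  let ρ : ℂ → Circle := fun z => if h : ‖q + T z * (z - q)‖ = 1 then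
    ⟨q + T z * (z - q), mem_sphere_zero_iff_norm.2 h⟩ else 1
  have hρ : ∀ z, z ≠ q → (ρ z : ℂ) = q + T z * (z - q) := by
    intro z hz
    rw [show ρ z = _ from dif_pos (hTn z hz)]
  refine ⟨ρ, ?_, ?_, fun z hz => ⟨T z, hT0 z hz, hρ z hz⟩⟩
  · refine (isInducing_circle_coe.continuousOn_iff (f := ρ)).2
      (ContinuousOn.congr (f := fun z => q + T z * (z - q)) ?_ fun z hz => hρ z hz)
    have hAc : Continuous A := Complex.continuous_normSq.comp (by fun_prop)
    have hBc : Continuous B := by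
      have h1 : Continuous fun z : ℂ => (z - q).re := Complex.continuous_re.comp (by fun_prop)
      have h2 : Continuous fun z : ℂ => (z - q).im := Complex.continuous_im.comp (by fun_prop)
      exact (continuous_const.mul h1).add (continuous_const.mul h2)
    have hTc : ContinuousOn T {q}ᶜ :=
      ContinuousOn.div (by fun_prop) hAc.continuousOn fun z hz => (hA z hz).ne'
    exact continuousOn_const.add
      ((Complex.continuous_ofReal.comp_continuousOn hTc).mul (by fun_prop))
  · intro c r hr
    have hcq : (c : ℂ) - q ≠ 0 := by
      rw [sub_ne_zero]
      intro h
      rw [← h, Circle.norm_coe] at hq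
      exact lt_irrefl _ hq
    have hr' : (r : ℂ) ≠ 0 := by exact_mod_cast hr.ne'
    have hz : q + r * (c - q) ≠ q := by simp [hcq, hr.ne']
    have heq : q + ((r⁻¹ : ℝ) : ℂ) * (q + r * (c - q) - q) = c := by
      push_cast
      field_simp
      ring
    have := huniq _ hz r⁻¹ (by positivity) (by rw [heq, Circle.norm_coe])
    apply Circle.ext
    rw [hρ _ hz, ← this, heq]

/-! ### The standard surface -/

section StandardSurface

variable {g : ℕ}

theorem coe_polygonPoint (n : ℕ) (s : ℝ) :
    (polygonPoint n s : ℂ) = Circle.exp (2 * Real.pi * s / n) := rfl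

theorem SideGluing.norm_left {z w : Metric.closedBall (0 : ℂ) 1} (h : SideGluing g z w) :
    ‖(z : ℂ)‖ = 1 := by
  cases h <;> exact Circle.norm_coe _

theorem SideGluing.norm_right {z w : Metric.closedBall (0 : ℂ) 1} (h : SideGluing g z w) :
    ‖(w : ℂ)‖ = 1 := by
  cases h <;> exact Circle.norm_coe _

theorem mk_polygonPoint_eq {j k : ℕ} (hj : j < g) (hk : k < 2) {t : ℝ} (ht : t ∈ I) :
    (Quot.mk _ (polygonPoint (4 * g) (4 * j + k + t)) : StandardSurface g) =
      Quot.mk _ (polygonPoint (4 * g) (4 * j + k + 3 - t)) := by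
  interval_cases k
  · simpa using Quot.sound (SideGluing.a j hj ⟨t, ht⟩)
  · have := Quot.sound (SideGluing.b j hj ⟨t, ht⟩)
    simp only at this
    convert! this using 3 <;> push_cast <;> ring

/-- Coordinates that detect the points of the open disk. -/
noncomputable def interiorCoordinate (g : ℕ) : StandardSurface g → ℝ × ℂ :=
  Quot.lift (fun z => (1 - ‖(z : ℂ)‖, ((1 - ‖(z : ℂ)‖ : ℝ) : ℂ) * z)) fun z w h => by
    simp [h.norm_left, h.norm_right]

theorem continuous_interiorCoordinate : Continuous (interiorCoordinate g) :=
  continuous_quot_lift _ (by fun_prop)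

/-- The first coordinate recovers the factor `1 - ‖z‖`, which is nonzero in the open disk and
cancels from the second. Only `z` has to be interior. -/
theorem eq_of_interiorCoordinate_eq {z w : Metric.closedBall (0 : ℂ) 1} (hz : ‖(z : ℂ)‖ < 1)
    (h : interiorCoordinate g (Quot.mk _ z) = interiorCoordinate g (Quot.mk _ w)) : z = w := by
  have h1 := congrArg Prod.fst h
  have h2 := congrArg Prod.snd h
  simp only [interiorCoordinate] at h1 h2
  rw [← h1] at h2
  have hne : ((1 - ‖(z : ℂ)‖ : ℝ) : ℂ) ≠ 0 := by
    exact_mod_cast (sub_pos.2 hz).ne'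
  exact Subtype.ext (mul_left_cancel₀ hne h2)

theorem eq_of_mk_eq_mk {z w : Metric.closedBall (0 : ℂ) 1} (hz : ‖(z : ℂ)‖ < 1)
    (h : (Quot.mk _ z : StandardSurface g) = Quot.mk _ w) : z = w :=
  eq_of_interiorCoordinate_eq hz (congrArg _ h)

/-- A map on the boundary of the polygon that respects the side identifications extends radially
to the surface punctured at a point of the open polygon. -/
theorem exists_radial_extension (hg : 1 ≤ g) {Y : Type*} [TopologicalSpace Y] {β : ℝ → Y}
    (hβ : ContinuousOn β (Icc 0 ((4 * g : ℕ) : ℝ))) (h0 : β 0 = β ((4 * g : ℕ) : ℝ))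
    (hglue : ∀ j k : ℕ, j < g → k < 2 → ∀ t ∈ I, β (4 * j + k + t) = β (4 * j + k + 3 - t))
    {q : Metric.closedBall (0 : ℂ) 1} (hq : ‖(q : ℂ)‖ < 1) :
    ∃ f : StandardSurface g → Y, ContinuousOn f {Quot.mk _ q}ᶜ ∧
      ∀ s ∈ Icc (0 : ℝ) ((4 * g : ℕ) : ℝ), ∀ r : ℝ, 0 < r → ∀ z : Metric.closedBall (0 : ℂ) 1,
        (z : ℂ) = q + r * (Circle.exp (2 * Real.pi * s / (4 * g : ℕ)) - q) →
        f (Quot.mk _ z) = β s := by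
  obtain ⟨b, hb⟩ := exists_continuousMap_circle (by omega) hβ h0
  obtain ⟨ρ, hρc, hρ, -⟩ := exists_radial_projection hq
  have hρ1 : ∀ s : ℝ, ρ (polygonPoint (4 * g) s) = Circle.exp (2 * Real.pi * s / (4 * g : ℕ)) :=
    fun s => by
      have := hρ (Circle.exp (2 * Real.pi * s / (4 * g : ℕ))) 1 one_pos
      rwa [Complex.ofReal_one, one_mul, add_sub_cancel] at this
  have hglue' : ∀ j k : ℕ, j < g → k < 2 → ∀ t ∈ I,
      b (ρ (polygonPoint (4 * g) (4 * j + k + t))) =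
        b (ρ (polygonPoint (4 * g) (4 * j + k + 3 - t))) := by
    intro j k hj hk t ht
    have hj' : (j : ℝ) + 1 ≤ g := by exact_mod_cast hj
    have hk' : (k : ℝ) ≤ 1 := by exact_mod_cast Nat.lt_succ_iff.1 hk
    have hj0 : (0 : ℝ) ≤ j := Nat.cast_nonneg _
    have hk0 : (0 : ℝ) ≤ k := Nat.cast_nonneg _
    rw [hρ1, hρ1, hb, hb, hglue j k hj hk t ht]
    · push_cast
      constructor <;> linarith [ht.1, ht.2]
    · push_cast
      constructor <;> linarith [ht.1, ht.2]
  -- The value at the puncture is arbitrary; continuity is claimed only away from it.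
  let f : StandardSurface g → Y := Quot.lift (fun z => b (ρ z)) fun z w h => by
    cases h with
    | a j hj t => simpa using hglue' j 0 hj (by norm_num) t t.2
    | b j hj t =>
      have := hglue' j 1 hj (by norm_num) t t.2
      convert! this using 5 <;> push_cast <;> ring
  refine ⟨f, ?_, ?_⟩
  · have hpre : (Quot.mk (SideGluing g)) ⁻¹' {Quot.mk _ q}ᶜ = {q}ᶜ := by
      ext z
      simp only [mem_preimage, mem_compl_iff, mem_singleton_iff, not_iff_not]
      exact ⟨fun h => (eq_of_mk_eq_mk hq h.symm).symm, fun h => by rw [h]⟩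
    have hopen : IsOpen ({Quot.mk _ q}ᶜ : Set (StandardSurface g)) := by
      rw [← isQuotientMap_quot_mk.isOpen_preimage, hpre]
      exact isOpen_compl_singleton
    rw [isQuotientMap_quot_mk.continuousOn_isOpen_iff hopen, hpre]
    refine b.continuous.comp_continuousOn (hρc.comp continuous_subtype_val.continuousOn ?_)
    intro z hz hzq
    exact hz (Subtype.ext hzq)
  · intro s hs r hr z hz
    change b (ρ z) = β s
    rw [hz, hρ _ _ hr, hb s hs]

/-! ### Separation of boundary points: the standard surface is Hausdorff -/

/-- A map from the line to the plane which is injective on `(0, 1)` and vanishes elsewhere. -/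
def bump (t : ℝ) : ℝ × ℝ := (max 0 (min t (1 - t)), max 0 (min t (1 - t)) * t)

theorem continuous_bump : Continuous bump := by
  unfold bump
  fun_prop

theorem bump_of_nonpos {t : ℝ} (ht : t ≤ 0) : bump t = 0 := by
  have : max 0 (min t (1 - t)) = 0 := max_eq_left ((min_le_left _ _).trans ht)
  simp [bump, this]

theorem bump_of_one_le {t : ℝ} (ht : 1 ≤ t) : bump t = 0 := by
  have : max 0 (min t (1 - t)) = 0 := max_eq_left ((min_le_right _ _).trans (by linarith))
  simp [bump, this]

theorem bump_fst_pos {t : ℝ} (ht : t ∈ Ioo (0 : ℝ) 1) : 0 < (bump t).1 :=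
  lt_max_of_lt_right (lt_min ht.1 (by linarith [ht.2]))

theorem eq_of_bump_eq {t t' : ℝ} (ht : t ∈ Ioo (0 : ℝ) 1) (h : bump t = bump t') : t = t' := by
  have h1 : (bump t).1 = (bump t').1 := congrArg Prod.fst h
  have h2 : (bump t).1 * t = (bump t').1 * t' := congrArg Prod.snd h
  rw [← h1] at h2
  exact mul_left_cancel₀ (bump_fst_pos ht).ne' h2

theorem bump_int_add_eq_zero {N : ℤ} (hN : N ≠ 0) {t : ℝ} (ht : t ∈ I) : bump (N + t) = 0 := by
  rcases lt_or_gt_of_ne hN with h | h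
  · have : (N : ℝ) ≤ -1 := by exact_mod_cast Int.le_sub_one_of_lt h
    exact bump_of_nonpos (by linarith [ht.2])
  · have : (1 : ℝ) ≤ N := by exact_mod_cast h
    exact bump_of_one_le (by linarith [ht.1])

theorem bump_int_sub_eq_zero {N : ℤ} (hN : N ≠ 1) {t : ℝ} (ht : t ∈ I) : bump (N - t) = 0 := by
  have := bump_int_add_eq_zero (N := N - 1) (by omega) (t := 1 - t) ⟨by linarith [ht.2], by linarith [ht.1]⟩
  convert this using 2
  push_cast
  ring

/-- Coordinates that detect the points of a pair of identified open sides. -/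
theorem exists_side_coordinate (hg : 1 ≤ g) {j k : ℕ} (hj : j < g) (hk : k < 2)
    {q : Metric.closedBall (0 : ℂ) 1} (hq : ‖(q : ℂ)‖ < 1) :
    ∃ f : StandardSurface g → ℝ × ℝ, ContinuousOn f {Quot.mk _ q}ᶜ ∧
      ∀ j' k' : ℕ, j' < g → k' < 2 → ∀ t ∈ I,
        f (Quot.mk _ (polygonPoint (4 * g) (4 * j' + k' + t))) =
          if j' = j ∧ k' = k then bump t else 0 := by
  -- One bump sits on side `4 * j + k`, and its mirror image on the partner side `4 * j + k + 2`, so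
  -- that `β` is compatible with the gluing.
  let β : ℝ → ℝ × ℝ := fun s => bump (s - (4 * j + k)) + bump (4 * j + k + 3 - s)
  have hleft : ∀ j' k' : ℕ, k' < 2 → ∀ t ∈ I,
      β (4 * j' + k' + t) = if j' = j ∧ k' = k then bump t else 0 := by
    intro j' k' hk' t ht
    have e1 : (4 * j' + k' + t - (4 * j + k) : ℝ) = ((4 * j' + k' - (4 * j + k) : ℤ) : ℝ) + t := by
      push_cast; ring
    have e2 : (4 * j + k + 3 - (4 * j' + k' + t) : ℝ) =
        ((4 * j + k + 3 - (4 * j' + k') : ℤ) : ℝ) - t := by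
      push_cast; ring
    simp only [β]
    rw [e1, e2, bump_int_sub_eq_zero (by omega) ht, add_zero]
    split_ifs with h
    · rw [h.1, h.2]; simp
    · exact bump_int_add_eq_zero (by omega) ht
  have hright : ∀ j' k' : ℕ, k' < 2 → ∀ t ∈ I,
      β (4 * j' + k' + 3 - t) = if j' = j ∧ k' = k then bump t else 0 := by
    intro j' k' hk' t ht
    have e1 : (4 * j' + k' + 3 - t - (4 * j + k) : ℝ) =
        ((4 * j' + k' + 3 - (4 * j + k) : ℤ) : ℝ) - t := by
      push_cast; ring
    have e2 : (4 * j + k + 3 - (4 * j' + k' + 3 - t) : ℝ) =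
        ((4 * j + k - (4 * j' + k') : ℤ) : ℝ) + t := by
      push_cast; ring
    simp only [β]
    rw [e1, e2, bump_int_sub_eq_zero (by omega) ht, zero_add]
    split_ifs with h
    · rw [h.1, h.2]; simp
    · exact bump_int_add_eq_zero (by omega) ht
  have hβc : Continuous β := by
    have := continuous_bump
    fun_prop
  have hjg : (j : ℝ) + 1 ≤ g := by exact_mod_cast hj
  have hk1 : (k : ℝ) ≤ 1 := by exact_mod_cast Nat.lt_succ_iff.1 hk
  have hj0 : (0 : ℝ) ≤ j := Nat.cast_nonneg _
  have hk0 : (0 : ℝ) ≤ k := Nat.cast_nonneg _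
  obtain ⟨f, hf, hf'⟩ := exists_radial_extension hg (β := β) hβc.continuousOn (by
    simp only [β]
    rw [bump_of_nonpos (by linarith), bump_of_one_le (by linarith),
      bump_of_one_le (by push_cast; linarith), bump_of_nonpos (by push_cast; linarith)])
    (fun j' k' _ hk' t ht => by rw [hleft j' k' hk' t ht, hright j' k' hk' t ht]) hq
  refine ⟨f, hf, fun j' k' hj' hk' t ht => ?_⟩
  rw [← hleft j' k' hk' t ht]
  refine hf' _ ?_ 1 one_pos _ ?_
  · have hj' : (j' : ℝ) + 1 ≤ g := by exact_mod_cast hj'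
    have hk' : (k' : ℝ) ≤ 1 := by exact_mod_cast Nat.lt_succ_iff.1 hk'
    push_cast
    exact ⟨by have := ht.1; positivity, by linarith [ht.2]⟩
  · simp [coe_polygonPoint]

/-- The endpoints of the glued sides identify all five vertices `4 * j, …, 4 * j + 4` of a block.
Consecutive blocks share a vertex, so all vertices become one point. -/
theorem mk_polygonPoint_vertex {j : ℕ} (hj : j < g) :
    (Quot.mk _ (polygonPoint (4 * g) (4 * j)) : StandardSurface g) =
        Quot.mk _ (polygonPoint (4 * g) 0) ∧
      (Quot.mk _ (polygonPoint (4 * g) (4 * j + 1)) : StandardSurface g) =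
        Quot.mk _ (polygonPoint (4 * g) 0) ∧
      (Quot.mk _ (polygonPoint (4 * g) (4 * j + 2)) : StandardSurface g) =
        Quot.mk _ (polygonPoint (4 * g) 0) := by
  have h : ∀ j < g,
      (Quot.mk _ (polygonPoint (4 * g) (4 * j)) : StandardSurface g) =
          Quot.mk _ (polygonPoint (4 * g) (4 * j + 3)) ∧
        (Quot.mk _ (polygonPoint (4 * g) (4 * j + 1)) : StandardSurface g) =
          Quot.mk _ (polygonPoint (4 * g) (4 * j + 2)) ∧
        (Quot.mk _ (polygonPoint (4 * g) (4 * j + 1)) : StandardSurface g) =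
          Quot.mk _ (polygonPoint (4 * g) (4 * j + 4)) ∧
        (Quot.mk _ (polygonPoint (4 * g) (4 * j + 2)) : StandardSurface g) =
          Quot.mk _ (polygonPoint (4 * g) (4 * j + 3)) := by
    intro j hj
    have a0 := mk_polygonPoint_eq hj (k := 0) (by norm_num) unitInterval.zero_mem
    have a1 := mk_polygonPoint_eq hj (k := 0) (by norm_num) unitInterval.one_mem
    have b0 := mk_polygonPoint_eq hj (k := 1) (by norm_num) unitInterval.zero_mem
    have b1 := mk_polygonPoint_eq hj (k := 1) (by norm_num) unitInterval.one_mem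
    norm_num [add_assoc, add_sub_assoc] at a0 a1 b0 b1
    exact ⟨a0, a1, b0, b1⟩
  have h4 : ∀ j < g, (Quot.mk _ (polygonPoint (4 * g) (4 * j)) : StandardSurface g) =
      Quot.mk _ (polygonPoint (4 * g) 0) := by
    intro j
    induction j with
    | zero => simp
    | succ j ih =>
      intro hj
      obtain ⟨h1, h2, h3, h4⟩ := h j (by omega)
      rw [← ih (by omega), h1, ← h4, ← h2, h3]
      congr 2
      push_cast
      ring
  obtain ⟨h1, h2, h3, h4'⟩ := h j hj
  exact ⟨h4 j hj, by rw [h2, h4', ← h1, h4 j hj], by rw [h4', ← h1, h4 j hj]⟩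

/-- Every boundary point of the polygon is identified with the vertex or with a point of one of the
first two sides in a group of four. -/
theorem mk_boundary_cases (hg : 1 ≤ g) {z : Metric.closedBall (0 : ℂ) 1} (hz : ‖(z : ℂ)‖ = 1) :
    (Quot.mk _ z : StandardSurface g) = Quot.mk _ (polygonPoint (4 * g) 0) ∨
      ∃ j k : ℕ, j < g ∧ k < 2 ∧ ∃ t ∈ Ioo (0 : ℝ) 1,
        (Quot.mk _ z : StandardSurface g) =
          Quot.mk _ (polygonPoint (4 * g) (4 * j + k + t)) := by
  obtain ⟨s, hs, hsz⟩ := exists_circle_exp_eq (n := 4 * g) (by omega)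
    ⟨(z : ℂ), mem_sphere_zero_iff_norm.2 hz⟩
  have hz' : z = polygonPoint (4 * g) s := Subtype.ext (by rw [coe_polygonPoint, hsz])
  have key : ∃ j k : ℕ, j < g ∧ k < 2 ∧ ∃ t ∈ Icc (0 : ℝ) 1,
      (Quot.mk _ z : StandardSurface g) = Quot.mk _ (polygonPoint (4 * g) (4 * j + k + t)) := by
    have hfl := Nat.floor_le hs.1
    have hfl' := Nat.lt_floor_add_one s
    have hm : ⌊s⌋₊ < 4 * g := (Nat.floor_lt hs.1).2 hs.2
    set m := ⌊s⌋₊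
    have hdm : (m : ℝ) = 4 * (m / 4 : ℕ) + (m % 4 : ℕ) := by
      exact_mod_cast (Nat.div_add_mod m 4).symm
    have hj : m / 4 < g := by omega
    have hi : m % 4 < 4 := Nat.mod_lt _ (by norm_num)
    rcases lt_or_ge (m % 4) 2 with h | h
    · refine ⟨m / 4, m % 4, hj, h, s - m, ⟨by linarith, by linarith⟩, ?_⟩
      rw [hz', ← hdm]
      congr 2
      ring
    -- The last two sides of a block are carried to the first two by the gluing, which reverses the
    -- parameter.
    · refine ⟨m / 4, m % 4 - 2, hj, by omega, 1 - (s - m), ⟨by linarith, by linarith⟩, ?_⟩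
      rw [hz', mk_polygonPoint_eq hj (by omega) ⟨by linarith, by linarith⟩]
      congr 2
      rw [Nat.cast_sub h]
      push_cast
      linarith
  obtain ⟨j, k, hj, hk, t, ht, h⟩ := key
  rcases ht.1.eq_or_lt with rfl | h0
  · left
    rw [h]
    interval_cases k
    · simpa using (mk_polygonPoint_vertex hj).1
    · simpa using (mk_polygonPoint_vertex hj).2.1
  rcases ht.2.eq_or_lt with rfl | h1
  · left
    rw [h]
    interval_cases k
    · simpa using (mk_polygonPoint_vertex hj).2.1
    · have := (mk_polygonPoint_vertex hj).2.2
      norm_num [add_assoc]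
      exact this
  · exact Or.inr ⟨j, k, hj, hk, t, ⟨h0, h1⟩, h⟩

theorem separated_of_continuousOn {X Y : Type*} [TopologicalSpace X] [TopologicalSpace Y]
    [T2Space Y] {U : Set X} (hU : IsOpen U) {f : X → Y} (hf : ContinuousOn f U) {x y : X}
    (hx : x ∈ U) (hy : y ∈ U) (hxy : f x ≠ f y) :
    ∃ u v : Set X, IsOpen u ∧ IsOpen v ∧ x ∈ u ∧ y ∈ v ∧ Disjoint u v := by
  obtain ⟨u, v, hu, hv, hxu, hyv, huv⟩ := t2_separation hxy
  exact ⟨U ∩ f ⁻¹' u, U ∩ f ⁻¹' v, hf.isOpen_inter_preimage hU hu, hf.isOpen_inter_preimage hU hv,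
    ⟨hx, hxu⟩, ⟨hy, hyv⟩, (huv.preimage f).mono inter_subset_right inter_subset_right⟩

theorem isOpen_compl_mk {q : Metric.closedBall (0 : ℂ) 1} (hq : ‖(q : ℂ)‖ < 1) :
    IsOpen ({Quot.mk _ q}ᶜ : Set (StandardSurface g)) := by
  have : ({Quot.mk _ q}ᶜ : Set (StandardSurface g)) =
      interiorCoordinate g ⁻¹' {interiorCoordinate g (Quot.mk _ q)}ᶜ := by
    ext x
    obtain ⟨z, rfl⟩ := Quot.exists_rep x
    simp only [mem_preimage, mem_compl_iff, mem_singleton_iff, not_iff_not]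
    exact ⟨fun h => by rw [h], fun h => by rw [eq_of_interiorCoordinate_eq hq h.symm]⟩
  rw [this]
  exact isOpen_compl_singleton.preimage continuous_interiorCoordinate

/-- `interiorCoordinate` separates an interior point from any other point. For two distinct boundary
points, at least one lies on an open side, and the coordinate of that side pair is injective there
and vanishes at the vertex and on the other side pairs. Hausdorffness is what makes the embedded
graph closed, hence `F₀` open. -/
theorem t2Space_standardSurface (hg : 1 ≤ g) : T2Space (StandardSurface g) := by
  refine ⟨fun x y hxy => ?_⟩
  obtain ⟨z, rfl⟩ := Quot.exists_rep x
  obtain ⟨w, rfl⟩ := Quot.exists_rep y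
  by_cases hzw : interiorCoordinate g (Quot.mk _ z) = interiorCoordinate g (Quot.mk _ w)
  swap
  · exact separated_of_continuousOn isOpen_univ continuous_interiorCoordinate.continuousOn
      (mem_univ _) (mem_univ _) hzw
  have hz : ‖(z : ℂ)‖ = 1 := le_antisymm (mem_closedBall_zero_iff.1 z.2) <| not_lt.1 fun h =>
    hxy (congrArg _ (eq_of_interiorCoordinate_eq h hzw))
  have hw : ‖(w : ℂ)‖ = 1 := le_antisymm (mem_closedBall_zero_iff.1 w.2) <| not_lt.1 fun h =>
    hxy (congrArg _ (eq_of_interiorCoordinate_eq h hzw.symm).symm)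
  let o : Metric.closedBall (0 : ℂ) 1 := ⟨0, by simp⟩
  have ho : ‖(o : ℂ)‖ < 1 := by simp [o]
  have hmem : ∀ z : Metric.closedBall (0 : ℂ) 1, ‖(z : ℂ)‖ = 1 →
      (Quot.mk _ z : StandardSurface g) ∈ ({Quot.mk _ o}ᶜ : Set (StandardSurface g)) := by
    intro z hz h
    rw [← eq_of_mk_eq_mk ho h.symm] at hz
    exact ho.ne hz
  have hsep : ∀ f : StandardSurface g → ℝ × ℝ, ContinuousOn f {Quot.mk _ o}ᶜ →
      f (Quot.mk _ z) ≠ f (Quot.mk _ w) → ∃ u v : Set (StandardSurface g), IsOpen u ∧ IsOpen v ∧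
        Quot.mk _ z ∈ u ∧ Quot.mk _ w ∈ v ∧ Disjoint u v := fun f hf h =>
    separated_of_continuousOn (isOpen_compl_mk ho) hf (hmem z hz) (hmem w hw) h
  have hv : ∀ f : StandardSurface g → ℝ × ℝ, ∀ j k : ℕ,
      (∀ j' k' : ℕ, j' < g → k' < 2 → ∀ t ∈ I,
        f (Quot.mk _ (polygonPoint (4 * g) (4 * j' + k' + t))) =
          if j' = j ∧ k' = k then bump t else 0) →
      f (Quot.mk _ (polygonPoint (4 * g) 0)) = 0 := by
    intro f j k h
    have := h 0 0 (by omega) (by norm_num) 0 unitInterval.zero_mem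
    simpa [bump_of_nonpos le_rfl] using this
  have hpos : ∀ {t : ℝ}, t ∈ Ioo (0 : ℝ) 1 → bump t ≠ 0 := fun ht h =>
    (bump_fst_pos ht).ne' (by rw [h]; rfl)
  rcases mk_boundary_cases hg hz with hz0 | ⟨j, k, hj, hk, t, ht, hz1⟩
  · rcases mk_boundary_cases hg hw with hw0 | ⟨j', k', hj', hk', t', ht', hw1⟩
    · exact absurd (hz0.trans hw0.symm) hxy
    · obtain ⟨f, hf, hf'⟩ := exists_side_coordinate hg hj' hk' ho
      refine hsep f hf ?_
      rw [hz0, hw1, hv f j' k' hf', hf' j' k' hj' hk' t' ⟨ht'.1.le, ht'.2.le⟩]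
      simpa using (hpos ht').symm
  · obtain ⟨f, hf, hf'⟩ := exists_side_coordinate hg hj hk ho
    refine hsep f hf fun heq => ?_
    rw [hz1, hf' j k hj hk t ⟨ht.1.le, ht.2.le⟩, if_pos ⟨rfl, rfl⟩] at heq
    rcases mk_boundary_cases hg hw with hw0 | ⟨j', k', hj', hk', t', ht', hw1⟩
    · rw [hw0, hv f j k hf'] at heq
      exact hpos ht heq
    · rw [hw1, hf' j' k' hj' hk' t' ⟨ht'.1.le, ht'.2.le⟩] at heq
      split_ifs at heq with h
      · rw [← eq_of_bump_eq ht heq, h.1, h.2] at hw1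
        exact hxy (hz1.trans hw1.symm)
      · exact hpos ht heq

end StandardSurface

/-! ### Lifting maps of disks and punctured disks -/

theorem continuous_polygonPoint (n : ℕ) : Continuous (polygonPoint n) :=
  Continuous.subtype_mk (continuous_subtype_val.comp (Circle.exp.continuous.comp (by fun_prop))) _

theorem polygonPoint_natCast_self {n : ℕ} (hn : 0 < n) : polygonPoint n n = polygonPoint n 0 := by
  have : (n : ℝ) ≠ 0 := by exact_mod_cast hn.ne'
  refine Subtype.ext ?_
  rw [coe_polygonPoint, coe_polygonPoint, mul_div_cancel_right₀ _ this]
  simp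

section Lifting

variable {G Z Y : Type*} [Group G] [TopologicalSpace Z] [TopologicalSpace Y] [MulAction G Z]
  {p : Z → Y} (hp : IsQuotientCoveringMap p G)
include hp

theorem exists_lift {A : Type*} [TopologicalSpace A] [SimplyConnectedSpace A]
    [LocallyPathConnectedSpace A] (f : C(A, Y)) : ∃ k : C(A, Z), ∀ a, p (k a) = f a := by
  obtain ⟨a₀⟩ : Nonempty A := inferInstance
  obtain ⟨z₀, hz₀⟩ := hp.surjective (f a₀)
  obtain ⟨k, ⟨-, hk⟩, -⟩ := hp.isCoveringMap.existsUnique_continuousMap_lifts f a₀ z₀ hz₀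
  exact ⟨k, congr_fun hk⟩

/-- A map of a punctured disk lifts to a covering if its restriction to the boundary does. -/
theorem exists_lift_punctured_disk {q : Metric.closedBall (0 : ℂ) 1} (hq : ‖(q : ℂ)‖ < 1)
    (f : C(({q}ᶜ : Set (Metric.closedBall (0 : ℂ) 1)), Y)) {n : ℕ} (hn : 0 < n) (K : C(ℝ, Z))
    (hK : ∀ s (z : ({q}ᶜ : Set (Metric.closedBall (0 : ℂ) 1))), z = polygonPoint n s →
      p (K s) = f z)
    (hKn : K n = K 0) :
    ∃ k : C(({q}ᶜ : Set (Metric.closedBall (0 : ℂ) 1)), Z), ∀ z, p (k z) = f z := by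
  obtain ⟨K₀, hK₀⟩ := exists_continuousMap_circle hn K.continuous.continuousOn hKn.symm
  obtain ⟨ρ, hρc, -, hρ⟩ := exists_radial_projection hq
  have hne : ∀ z : ({q}ᶜ : Set (Metric.closedBall (0 : ℂ) 1)), (z : ℂ) ≠ q :=
    fun z h => z.2 (Subtype.ext h)
  have hρc' : Continuous fun z : ({q}ᶜ : Set (Metric.closedBall (0 : ℂ) 1)) => ρ z :=
    hρc.comp_continuous (by fun_prop) hne
  have hmem : ∀ (t : I) (z : ({q}ᶜ : Set (Metric.closedBall (0 : ℂ) 1))),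
      (1 - t : ℝ) * (ρ z : ℂ) + (t : ℝ) * (z : ℂ) ∈ Metric.closedBall (0 : ℂ) 1 := by
    intro t z
    have h := convex_closedBall (0 : ℂ) 1
      (mem_closedBall_zero_iff.2 (Circle.norm_coe (ρ z)).le) z.1.2
      (sub_nonneg.2 t.2.2) t.2.1 (sub_add_cancel _ _)
    simpa only [Complex.real_smul] using h
  -- The point at time `t` is `q + ((1 - t) r + t) (z - q)` with `r > 0`; the coefficient is
  -- positive, so the segment avoids `q`.
  have hmem' : ∀ (t : I) (z : ({q}ᶜ : Set (Metric.closedBall (0 : ℂ) 1))),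
      (⟨_, hmem t z⟩ : Metric.closedBall (0 : ℂ) 1) ∈ ({q}ᶜ : Set _) := by
    intro t z h
    obtain ⟨r, hr, hρr⟩ := hρ z (hne z)
    have h' : (1 - t : ℝ) * (ρ z : ℂ) + (t : ℝ) * (z : ℂ) = q := congrArg Subtype.val h
    have h0 : (((1 - t : ℝ) * r + t : ℝ) : ℂ) * ((z : ℂ) - q) = 0 := by
      rw [hρr] at h'
      push_cast at h' ⊢
      linear_combination h'
    rcases mul_eq_zero.1 h0 with h0 | h0
    · have h1 : (1 - t : ℝ) * r + t = 0 := by exact_mod_cast h0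
      rcases t.2.1.eq_or_lt with ht | ht
      · rw [← ht] at h1
        linarith
      · have := mul_nonneg (sub_nonneg.2 t.2.2) hr.le
        linarith
    · exact hne z (sub_eq_zero.1 h0)
  -- This is the straight-line homotopy from the radial projection to the identity. Its start lifts
  -- through the boundary lift `K₀`, and the lifted homotopy at time `1` is the required map.
  let Q : C(I × ({q}ᶜ : Set (Metric.closedBall (0 : ℂ) 1)), ({q}ᶜ : Set (Metric.closedBall (0 : ℂ) 1))) :=
    ⟨fun a => ⟨⟨_, hmem a.1 a.2⟩, hmem' a.1 a.2⟩, by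
      have h1 : Continuous fun a : I × ({q}ᶜ : Set (Metric.closedBall (0 : ℂ) 1)) =>
          (ρ a.2 : ℂ) := continuous_subtype_val.comp (hρc'.comp continuous_snd)
      refine Continuous.subtype_mk (Continuous.subtype_mk ?_ _) _
      fun_prop⟩
  have hstart : ∀ z, (f.comp Q) (0, z) = p (K₀ (ρ z)) := by
    intro z
    obtain ⟨s, hs, hsz⟩ := exists_circle_exp_eq hn (ρ z)
    rw [← hsz, hK₀ s ⟨hs.1, hs.2.le⟩, hK s (Q (0, z))]
    · rfl
    · refine Subtype.ext ?_
      simp [Q, coe_polygonPoint, hsz]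
  let k := hp.isCoveringMap.liftHomotopy (f.comp Q) ⟨fun z => K₀ (ρ z), K₀.continuous.comp hρc'⟩ hstart
  refine ⟨⟨fun z => k (1, z), by fun_prop⟩, fun z => ?_⟩
  have h := congr_fun (hp.isCoveringMap.liftHomotopy_lifts (f.comp Q)
    ⟨fun z => K₀ (ρ z), K₀.continuous.comp hρc'⟩ hstart) (1, z)
  refine h.trans ?_
  change f (Q (1, z)) = f z
  congr 1
  refine Subtype.ext (Subtype.ext ?_)
  simp [Q]

omit hp [TopologicalSpace Y] in
/-- A path that runs over the boundary of a handle and ends at the translate of its starting point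
by a commutator. -/
theorem exists_commutator_path [ContinuousConstSMul G Z] (hmap : ∀ (h : G) z, p (h • z) = p z)
    {z₀ : Z} (hz₀ : ∀ h : G, Joined z₀ (h • z₀)) (x y : G) :
    ∃ L : C(ℝ, Z), L 0 = z₀ ∧ (∀ s, 4 ≤ s → L s = (x * y * x⁻¹ * y⁻¹) • z₀) ∧
      (∀ t ∈ I, p (L t) = p (L (3 - t))) ∧ ∀ t ∈ I, p (L (1 + t)) = p (L (4 - t)) := by
  obtain ⟨α⟩ := hz₀ x
  obtain ⟨β⟩ := hz₀ y
  have hα := α.continuous_extend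
  have hβ := β.continuous_extend
  -- The four pieces are `α`, `x • β`, then `α` and `β` reversed. The translating elements make the
  -- ends match: the path visits `z₀`, `x • z₀`, `(x * y) • z₀`, `(x * y * x⁻¹) • z₀`, and stops at
  -- the commutator translate. After time `4` it stays put, because `β.extend` is constant on
  -- negative arguments.
  let L₃ : ℝ → Z := fun s => if s ≤ 3 then (x * y * x⁻¹) • α.extend (3 - s)
    else (x * y * x⁻¹ * y⁻¹) • β.extend (4 - s)
  let L₂ : ℝ → Z := fun s => if s ≤ 2 then x • β.extend (s - 1) else L₃ s
  let L₁ : ℝ → Z := fun s => if s ≤ 1 then α.extend s else L₂ s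
  have c₃ : Continuous L₃ := by
    refine Continuous.if_le ((hα.comp (by fun_prop)).const_smul _)
      ((hβ.comp (by fun_prop)).const_smul _) continuous_id continuous_const ?_
    rintro s rfl
    norm_num [mul_smul]
  have c₂ : Continuous L₂ := by
    refine Continuous.if_le ((hβ.comp (by fun_prop)).const_smul _) c₃ continuous_id
      continuous_const ?_
    rintro s rfl
    norm_num [L₃, mul_smul]
  have c₁ : Continuous L₁ := by
    refine Continuous.if_le hα c₂ continuous_id continuous_const ?_
    rintro s rfl
    norm_num [L₂]
  refine ⟨⟨L₁, c₁⟩, by simp [L₁], fun s hs => ?_, fun t ht => ?_, fun t ht => ?_⟩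
  · have h1 : ¬ s ≤ 1 := by linarith
    have h2 : ¬ s ≤ 2 := by linarith
    have h3 : ¬ s ≤ 3 := by linarith
    simp only [ContinuousMap.coe_mk, L₁, L₂, L₃, if_neg h1, if_neg h2, if_neg h3]
    rw [β.extend_of_le_zero (by linarith)]
  · have e1 : p (L₁ t) = p (α.extend t) := by simp only [L₁, if_pos ht.2]
    have e2 : p (L₁ (3 - t)) = p (α.extend t) := by
      have h1 : ¬ 3 - t ≤ 1 := by linarith [ht.2]
      rcases ht.2.eq_or_lt with rfl | h
      · norm_num [L₁, L₂, hmap]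
      · have h2 : ¬ 3 - t ≤ 2 := by linarith
        have h3 : 3 - t ≤ 3 := by linarith [ht.1]
        simp only [L₁, L₂, L₃, if_neg h1, if_neg h2, if_pos h3, hmap, sub_sub_cancel]
    exact e1.trans e2.symm
  · have e1 : p (L₁ (1 + t)) = p (β.extend t) := by
      rcases ht.1.eq_or_lt with rfl | h
      · norm_num [L₁, hmap]
      · have h1 : ¬ 1 + t ≤ 1 := by linarith
        have h2 : 1 + t ≤ 2 := by linarith [ht.2]
        simp only [L₁, L₂, if_neg h1, if_pos h2, hmap, add_sub_cancel_left]
    have e2 : p (L₁ (4 - t)) = p (β.extend t) := by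
      have h1 : ¬ 4 - t ≤ 1 := by linarith [ht.2]
      have h2 : ¬ 4 - t ≤ 2 := by linarith [ht.2]
      rcases ht.2.eq_or_lt with rfl | h
      · norm_num [L₁, L₂, L₃, hmap]
      · have h3 : ¬ 4 - t ≤ 3 := by linarith
        simp only [L₁, L₂, L₃, if_neg h1, if_neg h2, if_neg h3, hmap, sub_sub_cancel]
    exact e1.trans e2.symm

end Lifting

/-! ### Faces of embedded graphs -/

/-- Shrinking a point of `U` slightly towards the centre keeps it in `U` and makes its norm less
than `1`. This allows the puncture to be placed in the open polygon. -/
theorem exists_interior_mem {U : Set (Metric.closedBall (0 : ℂ) 1)} (hU : IsOpen U)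
    (hne : U.Nonempty) : ∃ q ∈ U, ‖(q : ℂ)‖ < 1 := by
  obtain ⟨z, hz⟩ := hne
  have hmem : ∀ t : I, (t : ℝ) * (z : ℂ) ∈ Metric.closedBall (0 : ℂ) 1 := fun t => by
    rw [mem_closedBall_zero_iff, norm_mul, Complex.norm_real, Real.norm_of_nonneg t.2.1]
    exact mul_le_one₀ t.2.2 (norm_nonneg _) (mem_closedBall_zero_iff.1 z.2)
  let c : I → Metric.closedBall (0 : ℂ) 1 := fun t => ⟨_, hmem t⟩
  have hc : Continuous c := Continuous.subtype_mk (by fun_prop) _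
  have h1 : (1 : I) ∈ c ⁻¹' U := by
    have : c 1 = z := Subtype.ext (by simp [c])
    rwa [mem_preimage, this]
  obtain ⟨t, ht, htU⟩ : ∃ t : I, t < 1 ∧ t ∈ c ⁻¹' U := by
    have h0 : (0 : I) < 1 := zero_lt_one
    obtain ⟨l, hl, hlU⟩ := exists_Ioc_subset_of_mem_nhds ((hU.preimage hc).mem_nhds h1) ⟨0, h0⟩
    obtain ⟨t, hlt, ht⟩ := exists_between hl
    exact ⟨t, ht, hlU ⟨hlt, ht.le⟩⟩
  refine ⟨c t, htU, ?_⟩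
  change ‖(t : ℝ) * (z : ℂ)‖ < 1
  rw [norm_mul, Complex.norm_real, Real.norm_of_nonneg t.2.1]
  have ht' : (t : ℝ) < 1 := ht
  nlinarith [t.2.1, norm_nonneg (z : ℂ), mem_closedBall_zero_iff.1 z.2]

namespace OrientedGraph.Embedding

variable {V E : Type*} {Γ : OrientedGraph V E} {S : Type*} [TopologicalSpace S]

theorem isClosed_support [T2Space S] [Finite V] [Finite E] (ι : Γ.Embedding S) :
    IsClosed ι.support :=
  ((finite_range ι.point).isCompact.union
    (isCompact_iUnion fun e => isCompact_range (ι.arc e).continuous)).isClosed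

theorem arc_mem_support (ι : Γ.Embedding S) (e : E) (t : I) : ι.arc e t ∈ ι.support :=
  Or.inr (mem_iUnion.2 ⟨e, mem_range_self t⟩)

theorem IsFace.subset_compl_support {ι : Γ.Embedding S} {F : Set S} (hF : ι.IsFace F) :
    F ⊆ ι.supportᶜ := by
  obtain ⟨x, -, rfl⟩ := hF
  exact connectedComponentIn_subset _ _

theorem IsFace.eq_of_mem {ι : Γ.Embedding S} {F F' : Set S} (hF : ι.IsFace F)
    (hF' : ι.IsFace F') {x : S} (hx : x ∈ F) (hx' : x ∈ F') : F = F' := by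
  obtain ⟨y, -, rfl⟩ := hF
  obtain ⟨y', -, rfl⟩ := hF'
  rw [connectedComponentIn_eq hx, connectedComponentIn_eq hx']

/-- The attaching map of a boundary loop sends the boundary of the polygon to the graph. -/
theorem mem_support_of_norm_eq_one {ι : Γ.Embedding S} {w : Γ.Loop}
    {h : Metric.closedBall (0 : ℂ) 1 → S}
    (hside : ∀ (i : Fin w.len) (t : I),
      h (polygonPoint w.len ((i : ℕ) + (t : ℝ))) = ι.arc (w.edge i) t)
    {z : Metric.closedBall (0 : ℂ) 1} (hz : ‖(z : ℂ)‖ = 1) : h z ∈ ι.support := by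
  obtain ⟨s, hs, hsz⟩ := exists_circle_exp_eq w.len_pos
    ⟨(z : ℂ), mem_sphere_zero_iff_norm.2 hz⟩
  have hz' : z = polygonPoint w.len s := Subtype.ext (by rw [coe_polygonPoint, hsz])
  have hfl := Nat.floor_le hs.1
  have hfl' := Nat.lt_floor_add_one s
  have := hside ⟨⌊s⌋₊, (Nat.floor_lt hs.1).2 hs.2⟩ ⟨s - ⌊s⌋₊, by linarith, by linarith⟩
  simp only [add_sub_cancel] at this
  rw [hz', this]
  exact ι.arc_mem_support _ _

end OrientedGraph.Embedding

/-! ### Monodromy of the pulled-back covering around faces -/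

section Holonomy

open OrientedGraph

variable {G Z Y : Type*} [Group G] [TopologicalSpace Z] [TopologicalSpace Y] [MulAction G Z]
  {p : Z → Y} (hp : IsQuotientCoveringMap p G)
  {V E : Type*} {Γ : OrientedGraph V E} {S : Type*} [TopologicalSpace S] {ι : Γ.Embedding S}
  {f : S → Y} {s : V → Z} {φ : Γ.Connection G}
include hp

/-- A connection `φ` is the monodromy of the pullback by `f` of the covering `p`. -/
def IsMonodromy (_ : IsQuotientCoveringMap p G) (ι : Γ.Embedding S) (f : S → Y) (s : V → Z)
    (φ : Γ.Connection G) : Prop :=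
  (∀ v, p (s v) = f (ι.point v)) ∧
    ∀ e (Λ : C(I, Z)), (∀ t, p (Λ t) = f (ι.arc e t)) → ∀ a : G, Λ 0 = a • s (Γ.tail e) →
      Λ 1 = (a * φ.val e) • s (Γ.head e)

theorem exists_isMonodromy {U : Set S} (hf : ContinuousOn f U) (hU : ι.support ⊆ U) :
    ∃ (s : V → Z) (φ : Γ.Connection G), IsMonodromy hp ι f s φ := by
  have hc : ∀ e, Continuous fun t => f (ι.arc e t) := fun e =>
    hf.comp_continuous (ι.arc e).continuous fun t => hU (ι.arc_mem_support e t)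
  refine exists_connection hp Γ (fun v => f (ι.point v)) (fun e => ⟨_, hc e⟩) ?_ ?_ ?_
  · intro e
    simp
  · intro e
    simp
  · intro e t
    simp [ι.arc_bar]

theorem IsMonodromy.holonomy_eq_one_iff (h : IsMonodromy hp ι f s φ) {U : Set S}
    (hf : ContinuousOn f U) (hU : ι.support ⊆ U) (w : Γ.Loop) (K : C(ℝ, Z))
    (hK : ∀ (i : Fin w.len) (t : I), p (K ((i : ℕ) + (t : ℝ))) = f (ι.arc (w.edge i) t)) :
    φ.holonomy w = 1 ↔ K w.len = K 0 := by
  have hc : ∀ e, Continuous fun t => f (ι.arc e t) := fun e =>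
    hf.comp_continuous (ι.arc e).continuous fun t => hU (ι.arc_mem_support e t)
  exact SurfaceGraph.holonomy_eq_one_iff hp (c := fun e => ⟨_, hc e⟩)
    (y := fun v => f (ι.point v)) (fun e => by simp) h.1 h.2 w K hK

/-- The holonomy is trivial around a face over which the covering is defined. -/
theorem IsMonodromy.trivialHolonomy (h : IsMonodromy hp ι f s φ) {U F : Set S}
    (hf : ContinuousOn f U) (hU : ι.support ⊆ U) (hFU : F ⊆ U) : ι.TrivialHolonomy φ F := by
  rintro w ⟨b, ⟨H, hH⟩, hside⟩
  have hbU : ∀ z, b z ∈ U := by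
    intro z
    rcases (mem_closedBall_zero_iff.1 z.2).lt_or_eq with hz | hz
    · rw [← hH ⟨z, mem_ball_zero_iff.2 hz⟩]
      exact hFU (H _).2
    · exact hU (Embedding.mem_support_of_norm_eq_one hside hz)
  have : SimplyConnectedSpace (Metric.closedBall (0 : ℂ) 1) :=
    have := (convex_closedBall (0 : ℂ) 1).contractibleSpace ⟨0, by simp⟩
    inferInstance
  have : LocallyPathConnectedSpace (Metric.closedBall (0 : ℂ) 1) :=
    (convex_closedBall (0 : ℂ) 1).locallyPathConnectedSpace
  -- The map is defined on the whole closed disk, which is simply connected. The restriction of its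
  -- lift to the boundary circle closes up automatically.
  obtain ⟨k, hk⟩ := exists_lift hp ⟨fun z => f (b z), hf.comp_continuous b.continuous hbU⟩
  rw [h.holonomy_eq_one_iff hp hf hU w
    ⟨fun s => k (polygonPoint w.len s), k.continuous.comp (continuous_polygonPoint _)⟩]
  · exact congrArg k (polygonPoint_natCast_self w.len_pos)
  · intro i t
    rw [← hside]
    exact hk _

/-- If the holonomy around a face is trivial, then the covering is trivial over the punctured
face. -/
theorem IsMonodromy.exists_lift_punctured_face (h : IsMonodromy hp ι f s φ) {F : Set S} {x : S}
    (hf : ContinuousOn f {x}ᶜ) (hF : ι.IsFace F) (hx : x ∈ F) {w : Γ.Loop}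
    (hw : ι.IsBoundaryLoop F w) (hol : φ.holonomy w = 1) :
    ∃ k : C((F \ {x} : Set S), Z), ∀ y, p (k y) = f y := by
  obtain ⟨b, ⟨H, hH⟩, hside⟩ := hw
  have hU : ι.support ⊆ {x}ᶜ := by
    rintro y hy rfl
    exact hF.subset_compl_support hx hy
  let q' : Metric.ball (0 : ℂ) 1 := H.symm ⟨x, hx⟩
  let q : Metric.closedBall (0 : ℂ) 1 := ⟨q', Metric.ball_subset_closedBall q'.2⟩
  have hq : ‖(q : ℂ)‖ < 1 := mem_ball_zero_iff.1 q'.2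
  have hbq : ∀ z ∈ ({q}ᶜ : Set (Metric.closedBall (0 : ℂ) 1)), b z ∈ ({x}ᶜ : Set S) := by
    intro z hz hzx
    rcases (mem_closedBall_zero_iff.1 z.2).lt_or_eq with hz1 | hz1
    · refine hz (Subtype.ext ?_)
      have h1 := hH ⟨z, mem_ball_zero_iff.2 hz1⟩
      have h2 : H ⟨z, mem_ball_zero_iff.2 hz1⟩ = ⟨x, hx⟩ := Subtype.ext (h1.trans hzx)
      have h3 := congrArg Subtype.val (H.eq_symm_apply.2 h2)
      exact h3
    · exact hU (Embedding.mem_support_of_norm_eq_one hside hz1) hzx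
  have hb1 : ∀ s, polygonPoint w.len s ∈ ({q}ᶜ : Set (Metric.closedBall (0 : ℂ) 1)) := by
    intro s hs
    have : polygonPoint w.len s = q := hs
    rw [← this, coe_polygonPoint, Circle.norm_coe] at hq
    exact lt_irrefl _ hq
  have hcont : ContinuousOn (fun z => f (b z)) {q}ᶜ := hf.comp b.continuous.continuousOn hbq
  -- The boundary circle is unrolled to the line, where a lift always exists. Trivial holonomy then
  -- says that this lift closes up, which is what lifting over the punctured disk requires.
  obtain ⟨K, hK⟩ := exists_lift hp ⟨fun s : ℝ => f (b (polygonPoint w.len s)),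
    hcont.comp_continuous (continuous_polygonPoint _) hb1⟩
  have hKn := (h.holonomy_eq_one_iff hp hf hU w K fun i t => by
    rw [← hside]
    exact hK _).1 hol
  obtain ⟨k, hk⟩ := exists_lift_punctured_disk hp hq
    ⟨fun z => f (b z), continuousOn_iff_continuous_domRestrict.1 hcont⟩ w.len_pos K
    (fun s z hz => by
      rw [hK]
      change f (b _) = f (b z)
      rw [hz]) hKn
  have hmem : ∀ y : (F \ {x} : Set S),
      (⟨H.symm ⟨y, y.2.1⟩, Metric.ball_subset_closedBall (H.symm ⟨y, y.2.1⟩).2⟩ :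
        Metric.closedBall (0 : ℂ) 1) ∈ ({q}ᶜ : Set _) := by
    intro y hy
    have h0 : (⟨H.symm ⟨y, y.2.1⟩, Metric.ball_subset_closedBall (H.symm ⟨y, y.2.1⟩).2⟩ :
        Metric.closedBall (0 : ℂ) 1) = q := hy
    have h0' := congrArg (fun z : Metric.closedBall (0 : ℂ) 1 => (z : ℂ)) h0
    have h1 : H.symm ⟨y, y.2.1⟩ = q' := Subtype.ext h0'
    exact y.2.2 (congrArg Subtype.val (H.symm.injective h1))
  refine ⟨⟨fun y => k ⟨_, hmem y⟩, k.continuous.comp ?_⟩, fun y => ?_⟩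
  · refine Continuous.subtype_mk (Continuous.subtype_mk ?_ _) _
    exact continuous_subtype_val.comp (H.symm.continuous.comp (Continuous.subtype_mk (by fun_prop) _))
  · refine (hk _).trans ?_
    exact congrArg f ((hH (H.symm ⟨y, y.2.1⟩)).symm.trans (by rw [H.apply_symm_apply]))

end Holonomy

/-! ### The circle around the puncture and the commutator -/

theorem exists_small_circle {U : Set (Metric.closedBall (0 : ℂ) 1)} (hU : IsOpen U)
    {q : Metric.closedBall (0 : ℂ) 1} (hq : q ∈ U) :
    ∃ r : ℝ, 0 < r ∧ ∀ c : Circle, ∃ h : (q : ℂ) + r * (c - q) ∈ Metric.closedBall (0 : ℂ) 1,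
      (⟨_, h⟩ : Metric.closedBall (0 : ℂ) 1) ∈ U := by
  obtain ⟨ε, hε, hεU⟩ := Metric.isOpen_iff.1 hU q hq
  have hq1 : ‖(q : ℂ)‖ ≤ 1 := mem_closedBall_zero_iff.1 q.2
  -- The bound `r ≤ 1` keeps the curve in the disk by convexity; as `‖c - q‖ ≤ 2`, the bound `r ≤ ε
  -- / 4` keeps it within `ε` of `q`.
  refine ⟨min 1 (ε / 4), by positivity, fun c => ?_⟩
  set r := min 1 (ε / 4)
  have hr0 : 0 < r := by positivity
  have hr1 : r ≤ 1 := min_le_left _ _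
  have hrε : r ≤ ε / 4 := min_le_right _ _
  have h : (q : ℂ) + r * (c - q) ∈ Metric.closedBall (0 : ℂ) 1 := by
    have h := convex_closedBall (0 : ℂ) 1 q.2 (mem_closedBall_zero_iff.2 (Circle.norm_coe c).le)
      (sub_nonneg.2 hr1) hr0.le (sub_add_cancel _ _)
    simp only [Complex.real_smul] at h
    convert h using 1
    push_cast
    ring
  refine ⟨h, hεU ?_⟩
  rw [Metric.mem_ball, Subtype.dist_eq, dist_eq_norm]
  change ‖(q : ℂ) + r * (c - q) - q‖ < ε
  rw [add_sub_cancel_left, norm_mul, Complex.norm_real, Real.norm_of_nonneg hr0.le]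
  have := (norm_sub_le (c : ℂ) q).trans (add_le_add (Circle.norm_coe c).le hq1)
  nlinarith

/-- On a graph embedded in a closed orientable surface of positive genus, there is a connection in
any given non-abelian group whose holonomy is trivial around all faces but a prescribed one. -/
theorem exists_connection_nontrivialHolonomy {S : Type*} [TopologicalSpace S] {g : ℕ}
    (hS : IsClosedOrientableSurface g S) {V E : Type*} [Finite V] [Finite E]
    (Γ : OrientedGraph V E) (ι : Γ.Embedding S)
    {G : Type*} [Group G] (hG : ∃ x y : G, x * y ≠ y * x) (F₀ : Set S) (hF₀ : ι.IsFace F₀) :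
    ∃ φ : Γ.Connection G,
      (∀ F, ι.IsFace F → F ≠ F₀ → ι.TrivialHolonomy φ F) ∧ ι.NontrivialHolonomy φ F₀ := by
  obtain ⟨hg, ⟨Φ⟩⟩ := hS
  obtain ⟨x, y, hxy⟩ := hG
  have := t2Space_standardSurface hg
  have : T2Space S := Φ.isEmbedding.t2Space
  have : LocallyPathConnectedSpace (Metric.closedBall (0 : ℂ) 1) :=
    (convex_closedBall (0 : ℂ) 1).locallyPathConnectedSpace
  have : LocallyPathConnectedSpace S := Φ.symm.isQuotientMap.locallyPathConnectedSpace
  have hF₀o : IsOpen F₀ := by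
    obtain ⟨x, -, rfl⟩ := hF₀
    exact ι.isClosed_support.isOpen_compl.connectedComponentIn
  let π : Metric.closedBall (0 : ℂ) 1 → S := fun z => Φ.symm (Quot.mk _ z)
  have hπ : Continuous π := Φ.symm.continuous.comp continuous_quot_mk
  have hπo := hF₀o.preimage hπ
  obtain ⟨q, hqF, hq⟩ : ∃ q ∈ π ⁻¹' F₀, ‖(q : ℂ)‖ < 1 := by
    refine exists_interior_mem hπo ?_
    obtain ⟨x, hx, rfl⟩ := hF₀
    obtain ⟨z, hz⟩ := Quot.exists_rep (Φ x)
    exact ⟨z, by simpa [π, hz] using mem_connectedComponentIn hx⟩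
  have hp := JoinSpace.isQuotientCoveringMap (G := G)
  set p := Quotient.mk (MulAction.orbitRel G (JoinSpace G))
  have hmap : ∀ (h : G) (z : JoinSpace G), p (h • z) = p z := fun h z => hp.map_smul h
  obtain ⟨L, hL0, hL4, hLa, hLb⟩ :=
    exists_commutator_path hmap (JoinSpace.joined_base_smul (G := G)) x y
  have hpL4 : ∀ s : ℝ, 4 ≤ s → p (L s) = p JoinSpace.base := fun s hs => by rw [hL4 s hs, hmap]
  have hg4 : (4 : ℝ) ≤ (4 * g : ℕ) := by exact_mod_cast (by omega : 4 ≤ 4 * g)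
  -- On `[0, 4]` the path `L` runs over the first handle; beyond `4` it is constant, so the
  -- remaining handles are glued trivially.
  obtain ⟨f, hf, hfL⟩ := exists_radial_extension hg (β := fun s => p (L s))
    (hp.isCoveringMap.continuous.comp L.continuous).continuousOn
    (by simp only [hL0, hpL4 _ hg4])
    (by
      intro j k hj hk t ht
      rcases Nat.eq_zero_or_pos j with rfl | hj0
      · interval_cases k
        · simpa using hLa t ht
        · have := hLb t ht
          norm_num
          exact this
      · have hj1 : (1 : ℝ) ≤ j := by exact_mod_cast hj0
        have hk0 : (0 : ℝ) ≤ k := Nat.cast_nonneg _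
        have := ht.1
        have := ht.2
        exact (hpL4 _ (by linarith)).trans (hpL4 _ (by linarith)).symm)
    hq
  let F : S → _ := fun a => f (Φ a)
  have hF : ContinuousOn F {π q}ᶜ := by
    refine hf.comp Φ.continuous.continuousOn ?_
    intro a ha haq
    exact ha (Φ.eq_symm_apply.2 haq)
  have hU : ι.support ⊆ {π q}ᶜ := by
    rintro a ha rfl
    exact hF₀.subset_compl_support hqF ha
  obtain ⟨s, φ, hφ⟩ := exists_isMonodromy hp hF hU
  refine ⟨φ, fun F' hF' hne => hφ.trivialHolonomy hp hF hU ?_, fun w hw hol => ?_⟩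
  -- Distinct faces are disjoint, so a face other than `F₀` does not contain the puncture.
  · rintro a ha rfl
    exact hne (hF'.eq_of_mem hF₀ ha hqF)
  obtain ⟨k, hk⟩ := hφ.exists_lift_punctured_face hp hF hF₀ hqF hw hol
  obtain ⟨r, hr, hrU⟩ := exists_small_circle hπo hqF
  choose hmem hmemU using hrU
  let c : ℝ → Circle := fun s => Circle.exp (2 * Real.pi * s / (4 * g : ℕ))
  have hc : Continuous c := Circle.exp.continuous.comp (by fun_prop)
  have hγ : ∀ s, π ⟨_, hmem (c s)⟩ ∈ F₀ \ {π q} := by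
    refine fun s => ⟨hmemU (c s), fun h => ?_⟩
    have h1 := congrArg Subtype.val (eq_of_mk_eq_mk hq (Φ.symm.injective h).symm)
    have h2 : (r : ℂ) * (c s - q) = 0 := by
      have h1 : (q : ℂ) = q + r * (c s - q) := h1
      linear_combination -h1
    rcases mul_eq_zero.1 h2 with h2 | h2
    · exact hr.ne' (by exact_mod_cast h2)
    · rw [← sub_eq_zero.1 h2, Circle.norm_coe] at hq
      exact lt_irrefl _ hq
  -- The small circle lies on the rays from `q` to the boundary, along which the radial extension is
  -- constant. Hence `M`, a closed curve, lifts the same path as `L`.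
  let M : ℝ → JoinSpace G := fun s => k ⟨_, hγ s⟩
  have hM : Continuous M := by
    refine k.continuous.comp (Continuous.subtype_mk (hπ.comp (Continuous.subtype_mk ?_ _)) _)
    have : Continuous fun s => (c s : ℂ) := continuous_subtype_val.comp hc
    fun_prop
  have hMp : ∀ s ∈ Icc (0 : ℝ) (4 * g : ℕ), p (M s) = p (L s) := by
    intro s hs
    refine (hk _).trans ?_
    simp only [F, π, Homeomorph.apply_symm_apply]
    exact hfL s hs r hr _ rfl
  have h0 : (0 : ℝ) ∈ Icc (0 : ℝ) (4 * g : ℕ) := ⟨le_rfl, by linarith⟩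
  have h4 : ((4 * g : ℕ) : ℝ) ∈ Icc (0 : ℝ) (4 * g : ℕ) := ⟨by linarith, le_rfl⟩
  have hMend : M (4 * g : ℕ) = M 0 := by
    have h := congrArg (fun z : Metric.closedBall (0 : ℂ) 1 => (z : ℂ))
      (polygonPoint_natCast_self (n := 4 * g) (by omega))
    have : c (4 * g : ℕ) = c 0 := Circle.ext h
    simp only [M, this]
  obtain ⟨a, ha⟩ := hp.apply_eq_iff_mem_orbit.1 (hMp 0 h0)
  -- Uniqueness of lifts gives `M = a • L` on the whole interval. Since `M` closes up, comparing the
  -- two ends of `L` forces the commutator of `x` and `y` to be `1`.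
  have heq := hp.isCoveringMap.eqOn_of_comp_eqOn (g₂ := fun s => a • L s) isPreconnected_Icc hM.continuousOn
    (L.continuous.const_smul a).continuousOn (fun s hs => by
      simp only [Function.comp, hmap, hMp s hs]) h0 ha.symm h4
  simp only [hMend, ← ha, hL0, hL4 _ hg4] at heq
  have h1 := (smul_eq_smul_iff_of_covering hp 1 (x * y * x⁻¹ * y⁻¹) JoinSpace.base).1
    (by rw [one_smul]; exact MulAction.injective a heq)
  exact hxy (by rw [eq_mul_inv_iff_mul_eq, one_mul, eq_mul_inv_iff_mul_eq] at h1; exact h1.symm)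

end SurfaceGraph

theorem mainTheorem6 {S : Type*} [TopologicalSpace S] {g : ℕ}
    (hS : SurfaceGraph.IsClosedOrientableSurface g S)
    {V E : Type*} [Finite V] [Finite E] (Γ : SurfaceGraph.OrientedGraph V E)
    (ι : Γ.Embedding S) (hι : ι.IsMap)
    {G : Type*} [Group G] (hG : ∃ x y : G, x * y ≠ y * x)
    (F₀ : Set S) (hF₀ : ι.IsFace F₀) :
    ∃ φ : Γ.Connection G,
      (∀ F, ι.IsFace F → F ≠ F₀ → ι.TrivialHolonomy φ F) ∧ ι.NontrivialHolonomy φ F₀ := by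
  exact SurfaceGraph.exists_connection_nontrivialHolonomy hS Γ ι hG F₀ hF₀
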